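/- Let $H$ be a separable infinite-dimensional complex Hilbert space, let $d\ge 0$, and let $B(H)^d$ be the space of $d$-tuples $x=(x^1,\dots,x^d)$ of bounded operators on $H$ with the norm topology; operators act on tuples coordinatewise. Let $D\subseteq B(H)^d$ be open, balanced ($\alpha x\in D$ whenever $x\in D$, $\alpha\in\mathbb C$, $|\alpha|\le 1$), and closed with respect to countable direct sums in the following sense: for every bounded sequence $x_1,x_2,\dots$ in $D$ for which there is an $\varepsilon>0$ such that all the balls $\{z:\|z-x_n\|<\varepsilon\}$ are contained in $D$, there is a unitary $u:H\to H\oplus H\oplus\cdots$ with $u^*(x_1\oplus x_2\oplus\cdots)u\in D$. (This holds in particular if such a $u$ exists for every bounded sequence in $D$.) Let $F:D\to B(H)$ satisfy: (a) (sequential strong operator continuity) if $x_n,x\in D$ and $x_n^i v\to x^i v$ for all $v\in H$ and all $i$, then $F(x_n)v\to F(x)v$ for all $v\in H$; (b) (intertwining preserving) (i) if $x,y\in D$, $T\in B(H)$ and $Tx^i=y^iT$ for all $i$, then $TF(x)=F(y)T$; (ii) if $(x_n)$ is a bounded sequence in $D$ and $s:H\to H\oplus H\oplus\cdots$ is an invertible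 bounded linear operator with $s^{-1}(x_1\oplus x_2\oplus\cdots)s\in D$, then $F(x_1)\oplus F(x_2)\oplus\cdots$ is bounded and $F\big(s^{-1}(x_1\oplus x_2\oplus\cdots)s\big)=s^{-1}\big(F(x_1)\oplus F(x_2)\oplus\cdots\big)s$. Then for every $x\in D$ the operator $F(x)$ lies in the norm-closed unital subalgebra of $B(H)$ generated by $x^1,\dots,x^d$. -/

import Mathlib

open Filter Topology

/-- The Hilbert space direct sum `H ⊕ H ⊕ ⋯` of countably many copies of `H`. -/
abbrev HilbertSumCopies (H : Type*) [NormedAddCommGroup H] : Type _ :=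
  lp (fun _ : ℕ => H) 2

/-- `B` is the bounded block diagonal operator `A 0 ⊕ A 1 ⊕ ⋯` on `H ⊕ H ⊕ ⋯`. -/
def IsDirectSum {H : Type*} [NormedAddCommGroup H] [InnerProductSpace ℂ H]
    (A : ℕ → H →L[ℂ] H) (B : HilbertSumCopies H →L[ℂ] HilbertSumCopies H) : Prop :=
  ∀ (v : HilbertSumCopies H) (n : ℕ), (B v) n = A n (v n)

/-- `y = s⁻¹ (A 0 ⊕ A 1 ⊕ ⋯) s`, the direct sum being a bounded operator. -/
def IsConjDirectSum {H : Type*} [NormedAddCommGroup H] [InnerProductSpace ℂ H]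
    (s : H ≃L[ℂ] HilbertSumCopies H) (A : ℕ → H →L[ℂ] H) (y : H →L[ℂ] H) : Prop :=
  ∃ B : HilbertSumCopies H →L[ℂ] HilbertSumCopies H, IsDirectSum A B ∧
    y = (s.symm : HilbertSumCopies H →L[ℂ] H) ∘L B ∘L (s : H →L[ℂ] HilbertSumCopies H)

/-- `F`, of which only the values on `D` matter, is intertwining preserving on `D`. -/
structure IntertwiningPreserving {H : Type*} [NormedAddCommGroup H] [InnerProductSpace ℂ H]
    {d : ℕ} (D : Set (Fin d → H →L[ℂ] H)) (F : (Fin d → H →L[ℂ] H) → H →L[ℂ] H) : Prop where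
  /-- If `T x = y T` (in every coordinate) then `T F(x) = F(y) T`. -/
  intertwine : ∀ x ∈ D, ∀ y ∈ D, ∀ T : H →L[ℂ] H,
    (∀ i, T ∘L x i = y i ∘L T) → T ∘L F x = F y ∘L T
  /-- If `y = s⁻¹ (x 0 ⊕ x 1 ⊕ ⋯) s` (in every coordinate) lies in `D`, then
  `F(y) = s⁻¹ (F(x 0) ⊕ F(x 1) ⊕ ⋯) s`. -/
  directSum : ∀ x : ℕ → Fin d → H →L[ℂ] H, (∀ n, x n ∈ D) →
    Bornology.IsBounded (Set.range x) →
    ∀ s : H ≃L[ℂ] HilbertSumCopies H, ∀ y ∈ D,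
      (∀ i, IsConjDirectSum s (fun n => x n i) (y i)) →
      IsConjDirectSum s (fun n => F (x n)) (F y)

/-- `F` is sequentially strong operator continuous on `D`. -/
def SSOC {H : Type*} [NormedAddCommGroup H] [InnerProductSpace ℂ H]
    {d : ℕ} (D : Set (Fin d → H →L[ℂ] H)) (F : (Fin d → H →L[ℂ] H) → H →L[ℂ] H) : Prop :=
  ∀ (x : ℕ → Fin d → H →L[ℂ] H) (y : Fin d → H →L[ℂ] H), (∀ n, x n ∈ D) → y ∈ D →
    (∀ i, ∀ v : H, Tendsto (fun n => x n i v) atTop (𝓝 (y i v))) →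
    ∀ v : H, Tendsto (fun n => F (x n) v) atTop (𝓝 (F y v))

/-- `D` is closed with respect to countable direct sums: for every bounded sequence in `D` that
stays at a positive distance from the complement of `D`, some unitary `u : H → H ⊕ H ⊕ ⋯` has
`u* (x 0 ⊕ x 1 ⊕ ⋯) u ∈ D`.

A set with this property for all bounded sequences in `D` satisfies the definition. The condition
on the distance is there because, for `d ≥ 1`, no nonempty bounded open set
has the property for all bounded sequences: in the open unit ball, norms `‖x n‖ → 1` make the direct sum leave the ball. -/
def ClosedUnderCountableDirectSums {H : Type*} [NormedAddCommGroup H] [InnerProductSpace ℂ H]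
    {d : ℕ} (D : Set (Fin d → H →L[ℂ] H)) : Prop :=
  ∀ x : ℕ → Fin d → H →L[ℂ] H, (∀ n, x n ∈ D) → Bornology.IsBounded (Set.range x) →
    (∃ ε > 0, ∀ n, Metric.ball (x n) ε ⊆ D) →
    ∃ u : H ≃ₗᵢ[ℂ] HilbertSumCopies H, ∃ y ∈ D,
      ∀ i, IsConjDirectSum u.toContinuousLinearEquiv (fun n => x n i) (y i)

/-! Fix `x` and let `A` be the closed unital algebra generated by its coordinates. The map `z ↦ F (z
• x)` is holomorphic on `{z | z • x ∈ D}`, which is connected because `D` is balanced. Near `0` its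
values lie in `A`, so its image in the quotient by `A` is a holomorphic function vanishing near `0`,
hence also at `z = 1`.

Holomorphy (`differentiableAt_smul`) comes from direct sums: they force `F` to be locally bounded,
and an upper triangular perturbation of `y ⊕ y ⊕ ⋯` turns a difference quotient of `F` into a corner
of a value of `F`.

Near `0`, `exists_hasSum_words` compares `x` with a scaled tuple `L` of creation operators on an
orthonormal family `e` indexed by words. For each `v` some `T` intertwines `L` with `x` and sends `e
[]` to `v`, so `F x v = T (F L (e []))`. Expanding `F L (e [])` along `e` gives a power series in
the words of `x`, with coefficients independent of `x` and `v`. -/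

/-! ### Local boundedness, continuity and holomorphy along complex lines. -/

section DirectSum

variable {H : Type*} [NormedAddCommGroup H] [InnerProductSpace ℂ H]

open scoped InnerProductSpace
open ContinuousLinearMap (adjoint)

/-- The isometric embedding of `H` as the `n`-th summand, under an identification of `H` with
`H ⊕ H ⊕ ⋯`. -/
noncomputable def summandEmbedding (u : H ≃ₗᵢ[ℂ] HilbertSumCopies H) (n : ℕ) : H →ₗᵢ[ℂ] H where
  toLinearMap := u.symm.toLinearEquiv.toLinearMap ∘ₗ
    lp.lsingle (E := fun _ : ℕ => H) 2 n
  norm_map' v := by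
    change ‖u.symm (lp.single 2 n v)‖ = ‖v‖
    rw [u.symm.norm_map]
    exact lp.norm_single (E := fun _ : ℕ => H) (p := 2) two_pos n v

lemma summandEmbedding_apply (u : H ≃ₗᵢ[ℂ] HilbertSumCopies H) (n : ℕ) (v : H) :
    summandEmbedding u n v = u.symm (lp.single 2 n v) := rfl

lemma IsConjDirectSum.apply_summandEmbedding {u : H ≃ₗᵢ[ℂ] HilbertSumCopies H}
    {A : ℕ → H →L[ℂ] H} {y : H →L[ℂ] H} (h : IsConjDirectSum u.toContinuousLinearEquiv A y)
    (n : ℕ) (v : H) : y (summandEmbedding u n v) = summandEmbedding u n (A n v) := by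
  obtain ⟨B, hB, rfl⟩ := h
  have hBn : B (lp.single 2 n v) = lp.single 2 n (A n v) := by
    refine lp.ext (funext fun k => ?_)
    rw [hB]
    by_cases hk : k = n
    · subst hk
      rw [lp.single_apply_self, lp.single_apply_self]
    · rw [lp.single_apply_ne _ _ _ hk, lp.single_apply_ne _ _ _ hk, map_zero]
  rw [summandEmbedding_apply, summandEmbedding_apply, ← hBn]
  change u.symm (B (u (u.symm _))) = _
  rw [u.apply_symm_apply]

variable [CompleteSpace H]

lemma adjoint_summandEmbedding_apply (u : H ≃ₗᵢ[ℂ] HilbertSumCopies H) (m n : ℕ) (v : H) :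
    adjoint (summandEmbedding u m).toContinuousLinearMap (summandEmbedding u n v)
      = (lp.single 2 n v : HilbertSumCopies H) m := by
  refine ext_inner_right ℂ fun w => ?_
  rw [ContinuousLinearMap.adjoint_inner_left, LinearIsometry.coe_toContinuousLinearMap,
    summandEmbedding_apply, summandEmbedding_apply, LinearIsometryEquiv.inner_map_map]
  exact lp.inner_single_right (G := fun _ : ℕ => H) m w _

/-- The direct sum of a sequence in `D` which is uniformly inside `D` is realised in `D` as an
operator tuple that restricts to the given tuples along isometries with orthogonal ranges. -/
lemma ClosedUnderCountableDirectSums.exists_isometries {d : ℕ} {D : Set (Fin d → H →L[ℂ] H)}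
    (hsum : ClosedUnderCountableDirectSums D) {x : ℕ → Fin d → H →L[ℂ] H} (hx : ∀ n, x n ∈ D)
    (hb : Bornology.IsBounded (Set.range x)) {ε : ℝ} (hε : 0 < ε)
    (hball : ∀ n, Metric.ball (x n) ε ⊆ D) :
    ∃ y ∈ D, ∃ J : ℕ → H →L[ℂ] H, (∀ n v, ‖J n v‖ = ‖v‖) ∧
      (∀ n v, adjoint (J n) (J n v) = v) ∧ (∀ m n v, m ≠ n → adjoint (J m) (J n v) = 0) ∧
      ∀ n i v, y i (J n v) = J n (x n i v) := by
  obtain ⟨u, y, hy, hconj⟩ := hsum x hx hb ⟨ε, hε, hball⟩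
  refine ⟨y, hy, fun n => (summandEmbedding u n).toContinuousLinearMap,
    fun n v => (summandEmbedding u n).norm_map v, fun n v => ?_, fun m n v hmn => ?_,
    fun n i v => (hconj i).apply_summandEmbedding n v⟩
  · exact (adjoint_summandEmbedding_apply u n n v).trans (lp.single_apply_self (E := fun _ : ℕ => H) 2 n v)
  · exact (adjoint_summandEmbedding_apply u m n v).trans (lp.single_apply_ne (E := fun _ : ℕ => H) 2 n v hmn)

/-- Otherwise some `x n` near `y` have `‖F (x n)‖ > n`. Their direct sum `Y` lies in `D`, and each
`F (x n)` is the restriction of the single bounded operator `F Y` to a summand. -/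
lemma IntertwiningPreserving.exists_bound {d : ℕ} {D : Set (Fin d → H →L[ℂ] H)}
    (hopen : IsOpen D) (hsum : ClosedUnderCountableDirectSums D)
    {F : (Fin d → H →L[ℂ] H) → H →L[ℂ] H} (hip : IntertwiningPreserving D F)
    {y : Fin d → H →L[ℂ] H} (hy : y ∈ D) :
    ∃ ε > 0, ∃ C, ∀ x ∈ Metric.ball y ε, x ∈ D ∧ ‖F x‖ ≤ C := by
  obtain ⟨ε, hε, hball⟩ := Metric.isOpen_iff.1 hopen y hy
  have hsub : Metric.ball y (ε / 2) ⊆ D :=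
    (Metric.ball_subset_ball (half_le_self hε.le)).trans hball
  refine ⟨ε / 2, half_pos hε, ?_⟩
  by_contra! h
  choose x hx hxF using fun n : ℕ => h n
  obtain ⟨Y, hY, J, hJn, -, -, hJ⟩ := hsum.exists_isometries (x := x) (fun n => hsub (hx n))
    (Metric.isBounded_ball.subset (Set.range_subset_iff.2 hx)) (half_pos hε)
    (fun n => (Metric.ball_subset_ball' (by
      have := Metric.mem_ball.1 (hx n)
      linarith)).trans hball)
  obtain ⟨n, hn⟩ := exists_nat_gt ‖F Y‖
  have hle : ‖F (x n)‖ ≤ ‖F Y‖ := by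
    refine ContinuousLinearMap.opNorm_le_bound _ (norm_nonneg _) fun v => ?_
    have := hip.intertwine (x n) (hsub (hx n)) Y hY (J n)
      (fun i => by ext v; exact (hJ n i v).symm)
    have hv : J n (F (x n) v) = F Y (J n v) := congr($this v)
    rw [← hJn n (F (x n) v), hv, ← hJn n v]
    exact (F Y).le_opNorm _
  exact absurd (hxF n (hsub (hx n))) (not_lt.2 (hle.trans hn.le))

/-- Block upper triangular perturbations of an infinite direct sum `y ⊕ y ⊕ ⋯`: `I` and `J` embed
the first two summands, and the corner `(p, m; 0, q)` replaces `(y, 0; 0, y)`. -/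
noncomputable def upperTriangular {d : ℕ} (Y y : Fin d → H →L[ℂ] H) (I J : H →L[ℂ] H)
    (p q m : Fin d → H →L[ℂ] H) : Fin d → H →L[ℂ] H := fun i =>
  Y i + I ∘L (p i - y i) ∘L adjoint I + J ∘L (q i - y i) ∘L adjoint J + I ∘L m i ∘L adjoint J

/-- Intertwining preserving functions of upper triangular perturbations of `y ⊕ y ⊕ ⋯`
compute difference quotients. -/
lemma IntertwiningPreserving.exists_differenceQuotient {d : ℕ} {D : Set (Fin d → H →L[ℂ] H)}
    (hopen : IsOpen D) (hsum : ClosedUnderCountableDirectSums D)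
    {F : (Fin d → H →L[ℂ] H) → H →L[ℂ] H} (hip : IntertwiningPreserving D F)
    {y : Fin d → H →L[ℂ] H} (hy : y ∈ D) :
    ∃ Y ∈ D, ∃ I J : H →L[ℂ] H, (∀ v, ‖I v‖ = ‖v‖) ∧ (∀ v, ‖J v‖ = ‖v‖) ∧
      ∀ p ∈ D, ∀ q ∈ D, ∀ c : ℂ, upperTriangular Y y I J p q (c • (p - q)) ∈ D →
        adjoint I ∘L F (upperTriangular Y y I J p q (c • (p - q))) ∘L J = c • (F p - F q) := by
  obtain ⟨ε, hε, hball⟩ := Metric.isOpen_iff.1 hopen y hy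
  obtain ⟨Y, hY, J, hJn, hJJ, hJJ', hJ⟩ := hsum.exists_isometries (x := fun _ => y) (fun _ => hy)
    (by simp) hε (fun _ => hball)
  refine ⟨Y, hY, J 0, J 1, hJn 0, hJn 1, fun p hp q hq c hQ => ?_⟩
  set Q := upperTriangular Y y (J 0) (J 1) p q (c • (p - q)) with hQdef
  have h01 (v : H) : adjoint (J 0) (J 1 v) = 0 := hJJ' 0 1 v (by norm_num)
  have h10 (v : H) : adjoint (J 1) (J 0 v) = 0 := hJJ' 1 0 v (by norm_num)
  have hQ0 (i : Fin d) (v : H) : Q i (J 0 v) = J 0 (p i v) := by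
    simp [hQdef, upperTriangular, hJ, hJJ, h10]
  have hQ1 (i : Fin d) (v : H) : Q i (J 1 v) = J 1 (q i v) + c • J 0 (p i v - q i v) := by
    simp [hQdef, upperTriangular, hJ, hJJ, h01]
  have h0 := hip.intertwine p hp Q hQ (J 0) fun i => by ext v; simp [hQ0]
  -- The corner `c • (p - q)` is exactly what makes `J 1 - c • J 0` intertwine `q` with `Q`.
  have h1 := hip.intertwine q hq Q hQ (J 1 - c • J 0) fun i => by
    ext v
    simp [hQ0, hQ1, smul_sub]
    abel
  ext v
  have h0' : J 0 (F p v) = F Q (J 0 v) := congr($h0 v)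
  have h1' : J 1 (F q v) - c • J 0 (F q v) = F Q (J 1 v - c • J 0 v) := congr($h1 v)
  rw [map_sub, map_smul, ← h0', eq_sub_iff_add_eq] at h1'
  simp [← h1', hJJ, h01, smul_sub]
  abel

lemma norm_comp_adjoint_le {I J : H →L[ℂ] H} (hI : ∀ v, ‖I v‖ = ‖v‖) (hJ : ∀ v, ‖J v‖ = ‖v‖)
    (A : H →L[ℂ] H) : ‖I ∘L A ∘L adjoint J‖ ≤ ‖A‖ := by
  have hJ' : ‖adjoint J‖ ≤ 1 := by
    rw [LinearIsometryEquiv.norm_map]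
    exact J.opNorm_le_bound zero_le_one fun v => by rw [hJ, one_mul]
  refine ContinuousLinearMap.opNorm_le_bound _ (norm_nonneg _) fun v => ?_
  calc ‖(I ∘L A ∘L adjoint J) v‖ = ‖A (adjoint J v)‖ := hI _
    _ ≤ ‖A‖ * (1 * ‖v‖) := A.le_opNorm_of_le ((adjoint J).le_of_opNorm_le hJ' v)
    _ = ‖A‖ * ‖v‖ := by rw [one_mul]

lemma norm_adjoint_comp_le {I J : H →L[ℂ] H} (hI : ∀ v, ‖I v‖ = ‖v‖) (hJ : ∀ v, ‖J v‖ = ‖v‖)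
    (A : H →L[ℂ] H) : ‖adjoint I ∘L A ∘L J‖ ≤ ‖A‖ := by
  have hI' : ‖adjoint I‖ ≤ 1 := by
    rw [LinearIsometryEquiv.norm_map]
    exact I.opNorm_le_bound zero_le_one fun v => by rw [hI, one_mul]
  refine ContinuousLinearMap.opNorm_le_bound _ (norm_nonneg _) fun v => ?_
  calc ‖(adjoint I ∘L A ∘L J) v‖ ≤ 1 * ‖A (J v)‖ := (adjoint I).le_of_opNorm_le hI' _
    _ ≤ ‖A‖ * ‖v‖ := by rw [one_mul, ← hJ v]; exact A.le_opNorm _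

lemma dist_upperTriangular_le {d : ℕ} {I J : H →L[ℂ] H} (hI : ∀ v, ‖I v‖ = ‖v‖)
    (hJ : ∀ v, ‖J v‖ = ‖v‖) (Y y p q m : Fin d → H →L[ℂ] H) :
    dist (upperTriangular Y y I J p q m) Y ≤ dist p y + dist q y + ‖m‖ := by
  refine (dist_pi_le_iff (by positivity)).2 fun i => ?_
  have h1 := (norm_comp_adjoint_le hI hI (p i - y i)).trans (norm_le_pi_norm (p - y) i)
  have h2 := (norm_comp_adjoint_le hJ hJ (q i - y i)).trans (norm_le_pi_norm (q - y) i)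
  have h3 := (norm_comp_adjoint_le hI hJ (m i)).trans (norm_le_pi_norm m i)
  rw [dist_eq_norm, dist_eq_norm, dist_eq_norm]
  have : upperTriangular Y y I J p q m i - Y i = I ∘L (p i - y i) ∘L adjoint I
      + J ∘L (q i - y i) ∘L adjoint J + I ∘L m i ∘L adjoint J := by
    simp only [upperTriangular]
    abel
  rw [this]
  exact norm_add₃_le.trans (by gcongr)

/-- Difference quotients based at `y` are corners of values of `F` near `Y`, where `F` is bounded;
this gives a Lipschitz estimate at `y`. -/
lemma IntertwiningPreserving.continuousAt {d : ℕ} {D : Set (Fin d → H →L[ℂ] H)}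
    (hopen : IsOpen D) (hsum : ClosedUnderCountableDirectSums D)
    {F : (Fin d → H →L[ℂ] H) → H →L[ℂ] H} (hip : IntertwiningPreserving D F)
    {y : Fin d → H →L[ℂ] H} (hy : y ∈ D) : ContinuousAt F y := by
  obtain ⟨Y, hY, I, J, hI, hJ, hQ⟩ := hip.exists_differenceQuotient hopen hsum hy
  obtain ⟨ε, hε, C, hC⟩ := hip.exists_bound hopen hsum hY
  have hlip : ∀ᶠ p in 𝓝 y, ‖F p - F y‖ ≤ (4 / ε * C) * ‖p - y‖ := by
    filter_upwards [Metric.ball_mem_nhds y (half_pos hε), hopen.mem_nhds hy] with p hp hpD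
    rcases eq_or_ne p y with rfl | hne
    · simp
    have hpos : 0 < ‖p - y‖ := norm_pos_iff.2 (sub_ne_zero.2 hne)
    -- The corner gets norm `ε / 4`, so with `dist p y < ε / 2` the perturbation stays within `ε` of
    -- `Y`.
    let c : ℂ := ((ε / 4 / ‖p - y‖ : ℝ) : ℂ)
    have hc : ‖c‖ = ε / 4 / ‖p - y‖ := by
      rw [Complex.norm_real, Real.norm_of_nonneg (by positivity)]
    have hm : ‖c • (p - y)‖ = ε / 4 := by
      rw [norm_smul, hc, div_mul_cancel₀ _ hpos.ne']
    have hdist := dist_upperTriangular_le hI hJ Y y p y (c • (p - y))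
    rw [dist_self, hm] at hdist
    obtain ⟨hD, hle⟩ := hC (upperTriangular Y y I J p y (c • (p - y))) (by
      rw [Metric.mem_ball] at hp ⊢
      linarith)
    have h := norm_adjoint_comp_le hI hJ (F (upperTriangular Y y I J p y (c • (p - y))))
    rw [hQ p hpD y hy c hD, norm_smul, hc] at h
    have h' := h.trans hle
    rw [div_mul_eq_mul_div, div_le_iff₀ hpos] at h'
    have : ‖F p - F y‖ = 4 / ε * (ε / 4 * ‖F p - F y‖) := by field_simp
    rw [this, mul_assoc]
    gcongr
  rw [ContinuousAt, tendsto_iff_norm_sub_tendsto_zero]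
  refine squeeze_zero' (.of_forall fun _ => norm_nonneg _) hlip ?_
  have : ContinuousAt (fun p => (4 / ε * C) * ‖p - y‖) y := by fun_prop
  simpa [ContinuousAt] using this

lemma IntertwiningPreserving.differentiableAt_smul {d : ℕ} {D : Set (Fin d → H →L[ℂ] H)}
    (hopen : IsOpen D) (hsum : ClosedUnderCountableDirectSums D)
    {F : (Fin d → H →L[ℂ] H) → H →L[ℂ] H} (hip : IntertwiningPreserving D F)
    {x : Fin d → H →L[ℂ] H} {w : ℂ} (hw : w • x ∈ D) :
    DifferentiableAt ℂ (fun z : ℂ => F (z • x)) w := by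
  obtain ⟨Y, hY, I, J, hI, hJ, hQ⟩ := hip.exists_differenceQuotient hopen hsum hw
  obtain ⟨ε, hε, hball⟩ := Metric.isOpen_iff.1 hopen Y hY
  obtain ⟨δ, hδ, hδx⟩ : ∃ δ : ℝ, 0 < δ ∧ δ * ‖x‖ < ε :=
    ⟨ε / (‖x‖ + 1), by positivity, by
      rw [div_mul_eq_mul_div, div_lt_iff₀ (by positivity)]
      nlinarith [norm_nonneg x]⟩
  -- For `z ≠ w` the corner `δ • x` is `c • (z • x - w • x)` with `c = δ / (z - w)`, so the corner
  -- of `F (Q z)` is `δ` times the slope. As `Q` is also defined at `w`, continuity of `F` at `Q w`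
  -- gives the limit.
  let Q : ℂ → Fin d → H →L[ℂ] H := fun z =>
    upperTriangular Y (w • x) I J (z • x) (w • x) ((δ : ℂ) • x)
  have hQc : Continuous Q := by
    refine continuous_pi fun i => ?_
    simp only [Q, upperTriangular, Pi.smul_apply]
    fun_prop
  have hQw : Q w ∈ D := by
    refine hball ((dist_upperTriangular_le hI hJ _ _ _ _ _).trans_lt ?_)
    simpa [norm_smul, abs_of_pos hδ] using hδx
  have hFQ : ContinuousAt (fun z => (δ : ℂ)⁻¹ • (adjoint I ∘L F (Q z) ∘L J)) w := by
    have : ContinuousAt (fun z => F (Q z)) w :=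
      ContinuousAt.comp (hip.continuousAt hopen hsum hQw) hQc.continuousAt
    have hcomp : ContinuousAt (fun z => adjoint I ∘L F (Q z) ∘L J) w :=
      continuousAt_const.clm_comp (this.clm_comp continuousAt_const)
    exact hcomp.const_smul (δ : ℂ)⁻¹
  refine (hasDerivAt_iff_tendsto_slope.2
    ((hFQ.tendsto.mono_left nhdsWithin_le_nhds).congr' ?_)).differentiableAt
  have hD : ∀ᶠ z in 𝓝 w, z • x ∈ D :=
    (continuous_id.smul continuous_const).continuousAt.eventually_mem (hopen.mem_nhds hw)
  filter_upwards [self_mem_nhdsWithin,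
    (hQc.continuousAt.eventually_mem (hopen.mem_nhds hQw)).filter_mono nhdsWithin_le_nhds,
    hD.filter_mono nhdsWithin_le_nhds] with z hz hzQ hzD
  have hzw : z - w ≠ 0 := sub_ne_zero.2 hz
  have hm : ((δ : ℂ) / (z - w)) • (z • x - w • x) = (δ : ℂ) • x := by
    rw [← sub_smul, smul_smul, div_mul_cancel₀ _ hzw]
  have h := hQ (z • x) hzD (w • x) hw ((δ : ℂ) / (z - w))
  rw [hm] at h
  have hδ' : (δ : ℂ) ≠ 0 := by exact_mod_cast hδ.ne'
  rw [h hzQ, slope_def_module, smul_smul]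
  congr 1
  field_simp

end DirectSum

/-! ### Noncommutative power series near the origin. -/

section Words

variable {H : Type*} [NormedAddCommGroup H] [InnerProductSpace ℂ H]

open scoped InnerProductSpace
open ContinuousLinearMap (adjoint)

/-- A contraction acting on an orthonormal family by an injective map of the indices, and as zero
on the orthogonal complement of the family. -/
lemma Orthonormal.exists_shift [CompleteSpace H] {ι : Type*} {e : ι → H} (he : Orthonormal ℂ e)
    {σ : ι → ι} (hσ : Function.Injective σ) :
    ∃ S : H →L[ℂ] H, ‖S‖ ≤ 1 ∧ (∀ j v, ⟪e (σ j), S v⟫_ℂ = ⟪e j, v⟫_ℂ) ∧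
      ∀ k v, k ∉ Set.range σ → ⟪e k, S v⟫_ℂ = 0 := by
  classical
  let U := he.orthogonalFamily.linearIsometry
  let U' := (he.comp σ hσ).orthogonalFamily.linearIsometry
  have hU (j : ι) : U (lp.single 2 j 1) = e j := by
    simp [U, he.orthogonalFamily.linearIsometry_apply_single]
  have hU' (j : ι) : U' (lp.single 2 j 1) = e (σ j) := by
    simp [U', (he.comp σ hσ).orthogonalFamily.linearIsometry_apply_single]
  refine ⟨U'.toContinuousLinearMap ∘L adjoint U.toContinuousLinearMap, ?_, fun j v => ?_,
    fun k v hk => ?_⟩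
  · refine (ContinuousLinearMap.opNorm_comp_le _ _).trans ?_
    rw [LinearIsometryEquiv.norm_map]
    exact mul_le_one₀ U'.norm_toContinuousLinearMap_le (norm_nonneg _)
      U.norm_toContinuousLinearMap_le
  · rw [← hU', ContinuousLinearMap.comp_apply, LinearIsometry.coe_toContinuousLinearMap,
      U'.inner_map_map, ContinuousLinearMap.adjoint_inner_right,
      LinearIsometry.coe_toContinuousLinearMap, hU]
  · have h := ((he.comp σ hσ).orthogonalFamily.hasSum_linearIsometry
      (adjoint U.toContinuousLinearMap v)).mapL (innerSL ℂ (e k))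
    refine h.unique ?_
    convert hasSum_zero with j
    have : ⟪e k, e (σ j)⟫_ℂ = 0 := he.2 fun h => hk ⟨j, h.symm⟩
    simp [this]

lemma exists_orthonormal_of_countable [CompleteSpace H] (hH : ¬ FiniteDimensional ℂ H) (ι : Type*)
    [Countable ι] : ∃ e : ι → H, Orthonormal ℂ e := by
  obtain ⟨w, b, -⟩ := exists_hilbertBasis ℂ H
  have : Infinite w := by
    by_contra h
    rw [not_infinite_iff_finite] at h
    have := Fintype.ofFinite w
    exact hH b.toOrthonormalBasis.toBasis.finiteDimensional_of_finite
  obtain ⟨f, hf⟩ := exists_injective_nat ι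
  exact ⟨_, b.orthonormal.comp _ ((Infinite.natEmbedding w).injective.comp hf)⟩

lemma norm_prod_map_le {d : ℕ} (x : Fin d → H →L[ℂ] H) (w : List (Fin d)) :
    ‖(w.map x).prod‖ ≤ ‖x‖ ^ w.length := by
  induction w with
  | nil => exact ContinuousLinearMap.norm_id_le
  | cons i w ih =>
    rw [List.map_cons, List.prod_cons, List.length_cons, pow_succ']
    exact (norm_mul_le _ _).trans (by gcongr; exact norm_le_pi_norm x i)

lemma summable_pow_length {d : ℕ} {q : ℝ} (hq : 0 ≤ q) (hdq : d * q < 1) :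
    Summable fun w : List (Fin d) => q ^ w.length := by
  rw [← (Equiv.sigmaFiberEquiv (List.length (α := Fin d))).summable_iff]
  refine (summable_sigma_of_nonneg fun _ => pow_nonneg hq _).2 ?_
  have hfin (n : ℕ) : Fintype { w : List (Fin d) // w.length = n } :=
    inferInstanceAs (Fintype (List.Vector (Fin d) n))
  have hcard (n : ℕ) : Fintype.card { w : List (Fin d) // w.length = n } = d ^ n := by
    have h : Fintype.card (List.Vector (Fin d) n) = d ^ n := by simp [card_vector]
    rw [← Nat.card_eq_fintype_card, ← h]
    exact Nat.card_eq_fintype_card (α := List.Vector (Fin d) n)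
  -- Grouped by length, the `d ^ n` words of length `n` contribute `(d * q) ^ n`.
  refine ⟨fun n => (hasSum_fintype _).summable, ?_⟩
  refine (summable_geometric_of_lt_one (by positivity) hdq).congr fun n => ?_
  rw [tsum_fintype, Finset.sum_congr rfl (g := fun _ => q ^ n)]
  · simp [hcard, mul_pow]
  · rintro ⟨w, hw⟩ -
    simp [← hw]

variable [CompleteSpace H]

/-- Near the origin, an intertwining preserving function is the sum of a noncommutative power
series. -/
lemma IntertwiningPreserving.exists_hasSum_words (hH : ¬ FiniteDimensional ℂ H) {d : ℕ}
    {D : Set (Fin d → H →L[ℂ] H)} {F : (Fin d → H →L[ℂ] H) → H →L[ℂ] H}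
    (hip : IntertwiningPreserving D F) {r : ℝ} (hr : 0 < r)
    (hball : Metric.closedBall 0 r ⊆ D) :
    ∃ c : List (Fin d) → ℂ, ∀ x ∈ D, d * (‖x‖ / r) < 1 →
      HasSum (fun w => c w • (w.map x).prod) (F x) := by
  obtain ⟨e, he⟩ := exists_orthonormal_of_countable hH (List (Fin d))
  choose S hS1 hS hS0 using fun i : Fin d =>
    he.exists_shift (σ := fun w => i :: w) (List.cons_injective)
  let L : Fin d → H →L[ℂ] H := fun i => (r : ℂ) • S i
  have hL : L ∈ D := hball <| by
    rw [mem_closedBall_zero_iff, pi_norm_le_iff_of_nonneg hr.le]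
    intro i
    rw [norm_smul, Complex.norm_real, Real.norm_of_nonneg hr.le]
    exact mul_le_of_le_one_right hr.le (hS1 i)
  have hr' : (r : ℂ) ≠ 0 := by exact_mod_cast hr.ne'
  refine ⟨fun w => ⟪e w, F L (e [])⟫_ℂ * ((r : ℂ) ^ w.length)⁻¹, fun x hx hxr => ?_⟩
  have hbound (w : List (Fin d)) :
      ‖((r : ℂ) ^ w.length)⁻¹ • (w.map x).prod‖ ≤ (‖x‖ / r) ^ w.length := by
    rw [norm_smul, norm_inv, norm_pow, Complex.norm_real, Real.norm_of_nonneg hr.le, div_pow,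
      div_eq_inv_mul]
    gcongr
    exact norm_prod_map_le x w
  have hsummable := summable_pow_length (div_nonneg (norm_nonneg x) hr.le) hxr
  have hsum (v : H) : Summable fun w : List (Fin d) =>
      (innerSL ℂ (e w)).smulRight (((r : ℂ) ^ w.length)⁻¹ • (w.map x).prod v) := by
    refine Summable.of_norm_bounded (hsummable.mul_right ‖v‖) fun w => ?_
    rw [ContinuousLinearMap.norm_smulRight_apply, innerSL_apply_norm, he.1, one_mul]
    exact (((r : ℂ) ^ w.length)⁻¹ • (w.map x).prod).le_of_opNorm_le (hbound w) v
  -- `T v` sends `e w` to `r ^ (-|w|)` times the word `w` in `x` applied to `v`, and kills the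
  -- complement of the family.
  let T (v : H) : H →L[ℂ] H := ∑' w : List (Fin d),
    (innerSL ℂ (e w)).smulRight (((r : ℂ) ^ w.length)⁻¹ • (w.map x).prod v)
  have hT (v u : H) : HasSum (fun w : List (Fin d) =>
      ⟪e w, u⟫_ℂ • ((r : ℂ) ^ w.length)⁻¹ • (w.map x).prod v) (T v u) :=
    (hsum v).hasSum.mapL (ContinuousLinearMap.apply ℂ H u)
  have hTe (v : H) : T v (e []) = v := by
    refine (hT v (e [])).unique ?_
    convert hasSum_single ([] : List (Fin d)) fun w hw => ?_
    · simp [he.1]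
    · have : ⟪e w, e []⟫_ℂ = 0 := he.2 hw
      simp [this]
  have hTL (v : H) (i : Fin d) : T v ∘L L i = x i ∘L T v := by
    ext u
    refine (hT v (L i u)).unique ?_
    have h := (hT v u).mapL (x i)
    change HasSum _ (x i (T v u))
    -- Only words beginning with `i` contribute to `T v (L i u)`, since `S i` maps into their span.
    rw [← (List.cons_injective (a := i)).hasSum_iff fun w hw => ?_]
    · convert h using 2 with w
      simp only [Function.comp_apply, L, _root_.smul_apply, inner_smul_right, hS,
        List.length_cons, List.map_cons, List.prod_cons, map_smul, smul_smul,
        mul_apply_eq_comp]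
      congr 1
      field_simp
      ring
    · simp [L, hS0 i w u hw]
  have hF (v : H) : F x v = T v (F L (e [])) := by
    have h : T v ∘L F L = F x ∘L T v := hip.intertwine L hL x hx (T v) (hTL v)
    have : T v (F L (e [])) = F x (T v (e [])) := congr($h (e []))
    rw [this, hTe]
  have hsumF : Summable fun w : List (Fin d) =>
      (⟪e w, F L (e [])⟫_ℂ * ((r : ℂ) ^ w.length)⁻¹) • (w.map x).prod := by
    refine Summable.of_norm_bounded (hsummable.mul_left ‖F L (e [])‖) fun w => ?_
    rw [mul_smul, norm_smul]
    gcongr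
    · exact (norm_inner_le_norm _ _).trans (by rw [he.1, one_mul])
    · exact hbound w
  convert hsumF.hasSum
  ext v
  rw [hF]
  refine (hT v _).unique ?_
  refine (hsumF.hasSum.mapL (ContinuousLinearMap.apply ℂ H v)).congr_fun fun w => ?_
  simp [smul_smul]

lemma IntertwiningPreserving.exists_forall_mem_adjoin (hH : ¬ FiniteDimensional ℂ H) {d : ℕ}
    {D : Set (Fin d → H →L[ℂ] H)} (hopen : IsOpen D) (h0 : 0 ∈ D)
    {F : (Fin d → H →L[ℂ] H) → H →L[ℂ] H} (hip : IntertwiningPreserving D F) :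
    ∀ᶠ x in 𝓝 (0 : Fin d → H →L[ℂ] H),
      F x ∈ (Algebra.adjoin ℂ (Set.range x)).topologicalClosure := by
  obtain ⟨r, hr, hball⟩ := Metric.nhds_basis_closedBall.mem_iff.1 (hopen.mem_nhds h0)
  obtain ⟨c, hc⟩ := hip.exists_hasSum_words hH hr hball
  have hcont : ContinuousAt (fun x : Fin d → H →L[ℂ] H => d * (‖x‖ / r)) 0 := by fun_prop
  filter_upwards [hopen.mem_nhds h0, 
    hcont.eventually_lt (continuousAt_const (y := (1 : ℝ))) (by simp)] with x hx hxr
  refine (Subalgebra.isClosed_topologicalClosure _).mem_of_tendsto (hc x hx hxr)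
    (.of_forall fun s => Subalgebra.le_topologicalClosure _ ?_)
  refine sum_mem fun w _ => Subalgebra.smul_mem _ (list_prod_mem fun a ha => ?_) _
  obtain ⟨i, -, rfl⟩ := List.mem_map.1 ha
  exact Algebra.subset_adjoin ⟨i, rfl⟩

end Words

/-! ### Continuation from the origin along a complex line. -/

lemma Balanced.isPreconnected_preimage_smul {E : Type*} [NormedAddCommGroup E] [NormedSpace ℂ E]
    {D : Set E} (hbal : Balanced ℂ D) (x : E) : IsPreconnected {z : ℂ | z • x ∈ D} := by
  rcases Set.eq_empty_or_nonempty {z : ℂ | z • x ∈ D} with h | ⟨w, hw⟩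
  · rw [h]
    exact isPreconnected_empty
  have hstar : StarConvex ℝ (0 : ℂ) {z : ℂ | z • x ∈ D} :=
    starConvex_zero_iff.2 fun z hz a ha0 ha1 => by
      have := hbal.smul_mem (a := (a : ℂ)) (by simpa [abs_of_nonneg ha0] using ha1) hz
      simpa [smul_smul] using this
  exact (hstar.isPathConnected (by simpa using hbal.zero_mem ⟨_, hw⟩)).isConnected.isPreconnected

theorem mainTheorem5 {H : Type*} [NormedAddCommGroup H] [InnerProductSpace ℂ H] [CompleteSpace H]
    [TopologicalSpace.SeparableSpace H] (hH : ¬ FiniteDimensional ℂ H) (d : ℕ)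
    (D : Set (Fin d → H →L[ℂ] H)) (hopen : IsOpen D) (hbal : Balanced ℂ D)
    (hsum : ClosedUnderCountableDirectSums D)
    (F : (Fin d → H →L[ℂ] H) → H →L[ℂ] H)
    (hssoc : SSOC D F) (hip : IntertwiningPreserving D F) :
    ∀ x ∈ D, F x ∈ (Algebra.adjoin ℂ (Set.range x)).topologicalClosure := by
  intro x hx
  have h0 : (0 : Fin d → H →L[ℂ] H) ∈ D := hbal.zero_mem ⟨x, hx⟩
  let A : Submodule ℂ (H →L[ℂ] H) :=
    Subalgebra.toSubmodule (Algebra.adjoin ℂ (Set.range x)).topologicalClosure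
  have hA : IsClosed (A : Set (H →L[ℂ] H)) := Subalgebra.isClosed_topologicalClosure _
  let Ω : Set ℂ := {z | z • x ∈ D}
  have hcont : Continuous fun z : ℂ => z • x := by fun_prop
  have hΩ : IsOpen Ω := hopen.preimage hcont
  have hdiff : DifferentiableOn ℂ (fun z : ℂ => A.mkQL (F (z • x))) Ω := fun z hz =>
    (A.mkQL.differentiableAt.comp z
      (hip.differentiableAt_smul hopen hsum hz)).differentiableWithinAt
  -- Near `0`, `F (z • x)` lies in the closed algebra generated by `z • x`, which is contained in
  -- that of `x`.
  have hzero : (fun z : ℂ => A.mkQL (F (z • x))) =ᶠ[𝓝 0] 0 := by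
    have h := hip.exists_forall_mem_adjoin hH hopen h0
    rw [← zero_smul ℂ x] at h
    filter_upwards [hcont.continuousAt.eventually h] with z hz
    refine (Submodule.Quotient.mk_eq_zero A).2 (Subalgebra.topologicalClosure_mono ?_ hz)
    refine Algebra.adjoin_le (Set.range_subset_iff.2 fun i => ?_)
    exact Subalgebra.smul_mem _ (Algebra.subset_adjoin (Set.mem_range_self i)) z
  have h := (hdiff.analyticOnNhd hΩ).eqOn_zero_of_preconnected_of_eventuallyEq_zero
    (hbal.isPreconnected_preimage_smul x) (show (0 : ℂ) ∈ Ω by simpa [Ω] using h0) hzero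
    (show (1 : ℂ) ∈ Ω by simpa [Ω] using hx)
  exact (Submodule.Quotient.mk_eq_zero A).1 (by simpa using h)
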